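/- **Corollary 1.3.** Let $n\ge 1$, let $\Gamma\subset\mathbb R^n$ be an open symmetric cone containing $\Gamma_+=\{\lambda\in\mathbb R^n:\lambda_i>0 \text{ for all } i\}$, and let $\gamma:\Gamma\to(0,\infty)$ satisfy: a) $\gamma$ is smooth and symmetric, i.e. invariant under permutations of $(\lambda_1,\dots,\lambda_n)$; b) $\gamma$ is $\alpha$-homogeneous, i.e. $\gamma(c\lambda)=c^\alpha\gamma(\lambda)$ for all $\lambda\in\Gamma$ and $c>0$; c) $\dfrac{\partial\gamma}{\partial\lambda_i}(\lambda)>0$ for all $\lambda\in\Gamma$ and $i=1,\dots,n$; d) $\gamma$ has a continuous extension $\gamma:\overline\Gamma\to[0,\infty)$ that vanishes on $\partial\Gamma$; where $\alpha>\tfrac12$. For a smooth function $u:\Omega\to\mathbb R$ on an open set $\Omega\subset\mathbb R^n$, let $\nu=(-Du,1)/\sqrt{1+|Du|^2}$ be the upward unit normal of its graph, and let $\lambda=(\lambda_1,\dots,\lambda_n)$ be the principal curvatures of the graph with respect to $\nu$, i.e. the eigenvalues of the Weingarten map $h^i_j=g^{ik}h_{kj}$, with signs such that the graph of a convex function has $\lambda_i\ge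 0$. The graph is a *$\gamma$-translator* (in the direction $e_{n+1}$) if $\lambda\in\overline\Gamma$ and $$\gamma(\lambda)=\langle\nu,e_{n+1}\rangle$$ at each of its points. It is *convex* if $\lambda_i\ge0$, and *strictly convex* if $\lambda_i>0$, for all $i$ at each of its points; it is *complete* if it is complete for its intrinsic distance; and it is *entire* if $\Omega=\mathbb R^n$. Assume that the bowl-type $\gamma$-translator is defined in a ball, that is: for some $r>0$ there is a function $b$ on the ball $B(0,r)\subset\mathbb R^n$ whose graph is a complete, rotationally symmetric (about the $x_{n+1}$-axis), strictly convex $\gamma$-translator. Then there is no complete convex entire $\gamma$-translator in $\mathbb R^{n+1}$. -/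

import Mathlib

open Set Filter Topology
open scoped ENNReal ContDiff

noncomputable section

namespace GammaTranslator

/-- `ℝⁿ`, the horizontal hyperplane. -/
abbrev Base (n : ℕ) := EuclideanSpace ℝ (Fin n)

/-- The ambient space `ℝⁿ⁺¹`; its last coordinate is the vertical one. -/
abbrev Ambient (n : ℕ) := EuclideanSpace ℝ (Fin (n + 1))

/-- The point `(x, t)` of `ℝⁿ⁺¹` with horizontal part `x` and height `t`. -/
def point {n : ℕ} (x : Base n) (t : ℝ) : Ambient n :=
  WithLp.toLp 2 (Fin.snoc (α := fun _ => ℝ) (fun i => x i) t)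

/-- The vertical unit vector `e_{n+1}`. -/
def vertical (n : ℕ) : Ambient n := point 0 1

/-! ### Curvature functions -/

/-- `γ` is an admissible curvature function on the cone `Γ`, homogeneous of degree `α`.
The function `γ` is positive on `Γ`, and its values on `closure Γ` are those of its continuous
extension, which is zero on the boundary; its values outside `closure Γ` play no role. -/
structure IsCurvatureFunction {n : ℕ} (Γ : Set (Fin n → ℝ)) (γ : (Fin n → ℝ) → ℝ) (α : ℝ) :
    Prop where
  isOpen_cone : IsOpen Γ
  smul_mem : ∀ κ ∈ Γ, ∀ c : ℝ, 0 < c → c • κ ∈ Γ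
  perm_mem : ∀ κ ∈ Γ, ∀ σ : Equiv.Perm (Fin n), κ ∘ σ ∈ Γ
  positive_cone_subset : {κ : Fin n → ℝ | ∀ i, 0 < κ i} ⊆ Γ
  pos : ∀ κ ∈ Γ, 0 < γ κ
  smooth : ContDiffOn ℝ ∞ γ Γ
  symmetric : ∀ κ ∈ Γ, ∀ σ : Equiv.Perm (Fin n), γ (κ ∘ σ) = γ κ
  degree_pos : 0 < α
  homogeneous : ∀ κ ∈ Γ, ∀ c : ℝ, 0 < c → γ (c • κ) = c ^ α * γ κ
  increasing : ∀ κ ∈ Γ, ∀ i, 0 < fderiv ℝ γ κ (Pi.single i 1)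
  continuousOn_closure : ContinuousOn γ (closure Γ)
  eq_zero_of_mem_frontier : ∀ κ ∈ frontier Γ, γ κ = 0

/-! ### Geometry of graphs -/

section Graph

variable {n : ℕ}

/-- The parametrization `x ↦ (x, u x)` of the graph of `u`. -/
def graphMap (u : Base n → ℝ) (x : Base n) : Ambient n := point x (u x)

/-- The graph of `u` over `Ω`, a subset of `ℝⁿ⁺¹`. -/
def graphOver (Ω : Set (Base n)) (u : Base n → ℝ) : Set (Ambient n) := graphMap u '' Ω

/-- The `i`-th partial derivative of a map defined on (a subset of) `ℝⁿ`. -/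
def pderiv {E : Type*} [NormedAddCommGroup E] [NormedSpace ℝ E] (i : Fin n) (F : Base n → E)
    (x : Base n) : E :=
  fderiv ℝ F x (EuclideanSpace.single i 1)

/-- The upward unit normal `(-∇u, 1) / √(1 + |∇u|²)` of the graph of `u`; for a convex graph it
is the inward one. -/
def unitNormal (u : Base n → ℝ) (x : Base n) : Ambient n :=
  (1 / Real.sqrt (1 + ‖gradient u x‖ ^ 2)) • point (-gradient u x) 1

/-- The metric tensor `g_{ij} = ⟨∂_i F, ∂_j F⟩` of the graph, `F = graphMap u`. -/
def metricTensor (u : Base n → ℝ) (x : Base n) : Matrix (Fin n) (Fin n) ℝ :=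
  Matrix.of fun i j => inner ℝ (pderiv i (graphMap u) x) (pderiv j (graphMap u) x)

/-- The second fundamental form `h_{ij} = ⟨∂_i ∂_j F, ν⟩` of the graph with respect to the
upward unit normal `ν` (so that graphs of convex functions have nonnegative `h`). -/
def secondFundamentalForm (u : Base n → ℝ) (x : Base n) : Matrix (Fin n) (Fin n) ℝ :=
  Matrix.of fun i j => inner ℝ (pderiv i (pderiv j (graphMap u)) x) (unitNormal u x)

/-- The Weingarten map `h^i_j = g^{ik} h_{kj}`. -/
def weingarten (u : Base n → ℝ) (x : Base n) : Matrix (Fin n) (Fin n) ℝ :=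
  (metricTensor u x)⁻¹ * secondFundamentalForm u x

/-- `κ = (κ₁, …, κₙ)` lists the principal curvatures of the graph of `u` over `x`: the
eigenvalues of the Weingarten map, with multiplicity (in some order). -/
def IsPrincipalCurvatureVector (u : Base n → ℝ) (x : Base n) (κ : Fin n → ℝ) : Prop :=
  (weingarten u x).charpoly = ∏ i, (Polynomial.X - Polynomial.C (κ i))

/-- The graph of `u` over `Ω` is convex: its principal curvatures are nonnegative. -/
def IsConvexGraph (Ω : Set (Base n)) (u : Base n → ℝ) : Prop :=
  ∀ x ∈ Ω, ∀ κ, IsPrincipalCurvatureVector u x κ → ∀ i, 0 ≤ κ i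

/-- The graph of `u` over `Ω` is strictly convex: its principal curvatures are positive. -/
def IsStrictlyConvexGraph (Ω : Set (Base n)) (u : Base n → ℝ) : Prop :=
  ∀ x ∈ Ω, ∀ κ, IsPrincipalCurvatureVector u x κ → ∀ i, 0 < κ i

/-- The intrinsic distance of `S ⊆ ℝⁿ⁺¹`: the infimum of the lengths of the paths in `S`. -/
def intrinsicEDist (S : Set (Ambient n)) (p q : Ambient n) : ℝ≥0∞ :=
  ⨅ c ∈ {c : ℝ → Ambient n |
    ContinuousOn c (Icc 0 1) ∧ MapsTo c (Icc 0 1) S ∧ c 0 = p ∧ c 1 = q},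
    eVariationOn c (Icc 0 1)

/-- `S` is complete for its intrinsic distance: intrinsic Cauchy sequences converge in `S`. -/
def IsIntrinsicallyComplete (S : Set (Ambient n)) : Prop :=
  ∀ s : ℕ → Ambient n, (∀ k, s k ∈ S) →
    (∀ ε : ℝ≥0∞, 0 < ε → ∃ N, ∀ k ≥ N, ∀ m ≥ N, intrinsicEDist S (s k) (s m) < ε) →
    ∃ p ∈ S, Tendsto (fun k => intrinsicEDist S (s k) p) atTop (𝓝 0)

/-- The graph of `u` over the open set `Ω` is a `γ`-translator in direction `e_{n+1}`: it is
smooth and `γ(κ) = ⟨ν, e_{n+1}⟩` at each point, `κ` being the principal curvature vector. -/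
structure IsGraphicalTranslator (Γ : Set (Fin n → ℝ)) (γ : (Fin n → ℝ) → ℝ)
    (Ω : Set (Base n)) (u : Base n → ℝ) : Prop where
  smooth : ContDiffOn ℝ ∞ u Ω
  equation : ∀ x ∈ Ω, ∃ κ, IsPrincipalCurvatureVector u x κ ∧ κ ∈ closure Γ ∧
    γ κ = inner ℝ (unitNormal u x) (vertical n)

/-- The graph of `b` is a bowl-type `γ`-translator defined in the ball of radius `r` about the
origin: a complete, rotationally symmetric, strictly convex graphical `γ`-translator over it. -/
structure IsBowlOverBall (Γ : Set (Fin n → ℝ)) (γ : (Fin n → ℝ) → ℝ)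
    (r : ℝ) (b : Base n → ℝ) : Prop where
  translator : IsGraphicalTranslator Γ γ (Metric.ball 0 r) b
  rotationally_symmetric :
    ∀ x ∈ Metric.ball (0 : Base n) r, ∀ y ∈ Metric.ball (0 : Base n) r, ‖x‖ = ‖y‖ → b x = b y
  strictly_convex : IsStrictlyConvexGraph (Metric.ball 0 r) b
  complete : IsIntrinsicallyComplete (graphOver (Metric.ball 0 r) b)

/-- The graph of `u` is a complete convex entire `γ`-translator. -/
structure IsCompleteConvexEntireTranslator (Γ : Set (Fin n → ℝ)) (γ : (Fin n → ℝ) → ℝ)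
    (u : Base n → ℝ) : Prop where
  translator : IsGraphicalTranslator Γ γ univ u
  convex : IsConvexGraph univ u
  complete : IsIntrinsicallyComplete (graphOver univ u)

end Graph

end GammaTranslator

end

namespace GammaTranslator

/-! ### Linear algebra -/

section LinearAlgebra

open scoped Matrix

variable {E : Type*} [NormedAddCommGroup E] [InnerProductSpace ℝ E] {n : ℕ}

/-! Suppose an entire convex translator `u` exists, and dilate the bowl by 2. Completeness forces
`b` to blow up at the boundary of its ball (`IsBowlOverBall.exists_lt_of_norm_ge`), so `2 b(·/2) -
u` has an interior minimum. There the two graphs have the same gradient and ordered Hessians, and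
Weyl monotonicity gives `2 κ ≤ μ` up to a permutation for the curvatures `κ` of `u` and `μ` of `b`
(`exists_perm_two_mul_le`). Monotonicity and homogeneity of `γ` then give `γ κ ≤ 2^(-α) γ μ < γ μ`.
But both values equal the vertical component of the unit normal, which depends only on the common
gradient: a contradiction. -/

theorem norm_sq_eq_sum_repr (e : OrthonormalBasis (Fin n) ℝ E) (x : E) :
    ‖x‖ ^ 2 = ∑ i, (e.repr x i) ^ 2 := by
  rw [← e.repr.norm_map, EuclideanSpace.norm_sq_eq]
  simp

variable [FiniteDimensional ℝ E]

theorem inner_apply_self_eq_sum {T : E →ₗ[ℝ] E} (hT : T.IsSymmetric)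
    (hn : Module.finrank ℝ E = n) (x : E) :
    inner ℝ (T x) x =
      ∑ i, hT.eigenvalues hn i * ((hT.eigenvectorBasis hn).repr x i) ^ 2 := by
  rw [← (hT.eigenvectorBasis hn).repr.inner_map_map, PiLp.inner_apply]
  refine Finset.sum_congr rfl fun i _ => ?_
  rw [hT.eigenvectorBasis_apply_self_apply]
  simp
  ring

/-- Weyl's monotonicity principle for the sorted eigenvalues of symmetric operators. -/
theorem eigenvalues_le_of_inner_le {S T : E →ₗ[ℝ] E} (hS : S.IsSymmetric) (hT : T.IsSymmetric)
    (hn : Module.finrank ℝ E = n) {c : ℝ} (hc : 0 ≤ c)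
    (h : ∀ x, c * inner ℝ (S x) x ≤ inner ℝ (T x) x) (k : Fin n) :
    c * hS.eigenvalues hn k ≤ hT.eigenvalues hn k := by
  -- Eigenvalues are sorted decreasingly. These `n - 1` linear conditions leave a nonzero `x`
  -- spanned both by `T`-eigenvectors of index at least `k` and by `S`-eigenvectors of index at most
  -- `k`. The quadratic forms at `x` compare the two `k`-th eigenvalues.
  let L : E →ₗ[ℝ] ({i : Fin n // i ≠ k} → ℝ) := LinearMap.pi fun i =>
    if (i : Fin n) < k then (hT.eigenvectorBasis hn).toBasis.coord i
    else (hS.eigenvectorBasis hn).toBasis.coord i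
  have hlt : Module.finrank ℝ ({i : Fin n // i ≠ k} → ℝ) < Module.finrank ℝ E := by
    rw [hn, Module.finrank_fintype_fun_eq_card, Fintype.card_subtype_compl]
    simp
    exact k.pos
  obtain ⟨x, hx, hx0⟩ := Submodule.exists_mem_ne_zero_of_ne_bot
    (LinearMap.ker_ne_bot_of_finrank_lt (f := L) hlt)
  have hL : ∀ i : {i : Fin n // i ≠ k}, L x i = 0 := fun i => by
    rw [LinearMap.mem_ker.1 hx]; rfl
  have hTx : ∀ i, i < k → (hT.eigenvectorBasis hn).repr x i = 0 := fun i hi => by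
    simpa [L, hi] using hL ⟨i, hi.ne⟩
  have hSx : ∀ i, k < i → (hS.eigenvectorBasis hn).repr x i = 0 := fun i hi => by
    simpa [L, hi.not_gt] using hL ⟨i, hi.ne'⟩
  have h1 : inner ℝ (T x) x ≤ hT.eigenvalues hn k * ‖x‖ ^ 2 := by
    rw [inner_apply_self_eq_sum hT hn, norm_sq_eq_sum_repr (hT.eigenvectorBasis hn),
      Finset.mul_sum]
    refine Finset.sum_le_sum fun i _ => ?_
    rcases lt_or_ge i k with hi | hi
    · simp [hTx i hi]
    · exact mul_le_mul_of_nonneg_right (hT.eigenvalues_antitone hn hi) (sq_nonneg _)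
  have h2 : hS.eigenvalues hn k * ‖x‖ ^ 2 ≤ inner ℝ (S x) x := by
    rw [inner_apply_self_eq_sum hS hn, norm_sq_eq_sum_repr (hS.eigenvectorBasis hn),
      Finset.mul_sum]
    refine Finset.sum_le_sum fun i _ => ?_
    rcases lt_or_ge k i with hi | hi
    · simp [hSx i hi]
    · exact mul_le_mul_of_nonneg_right (hS.eigenvalues_antitone hn hi) (sq_nonneg _)
  have hpos : 0 < ‖x‖ ^ 2 := by positivity
  refine le_of_mul_le_mul_right ?_ hpos
  calc c * hS.eigenvalues hn k * ‖x‖ ^ 2 = c * (hS.eigenvalues hn k * ‖x‖ ^ 2) := by ring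
    _ ≤ c * inner ℝ (S x) x := mul_le_mul_of_nonneg_left h2 hc
    _ ≤ _ := (h x).trans h1

theorem inner_toEuclideanLin_self {ι : Type*} [Fintype ι] [DecidableEq ι] (A : Matrix ι ι ℝ)
    (x : EuclideanSpace ℝ ι) :
    inner ℝ (Matrix.toEuclideanLin A x) x = x.ofLp ⬝ᵥ A *ᵥ x.ofLp := by
  simp [EuclideanSpace.inner_eq_star_dotProduct, Matrix.toLpLin_apply]

/-- Both families of eigenvalues are the sorted ones under the same reindexing of `ι`, so Weyl's
comparison applies index by index. -/
theorem matrix_eigenvalues_le {ι : Type*} [Fintype ι] [DecidableEq ι] {A B : Matrix ι ι ℝ}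
    (hA : A.IsHermitian) (hB : B.IsHermitian) {c : ℝ} (hc : 0 ≤ c)
    (h : (B - c • A).PosSemidef) (i : ι) : c * hA.eigenvalues i ≤ hB.eigenvalues i := by
  refine eigenvalues_le_of_inner_le _ _ _ hc (fun x => ?_) _
  have := h.dotProduct_mulVec_nonneg x.ofLp
  rw [Matrix.sub_mulVec, dotProduct_sub, Matrix.smul_mulVec, dotProduct_smul] at this
  rw [inner_toEuclideanLin_self, inner_toEuclideanLin_self]
  simpa using this

/-- Equal multisets of roots mean that `κ` and `μ` have equinumerous fibres over every value;
bijections between the fibres glue to a permutation. -/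
theorem exists_perm_of_prod_X_sub_C_eq {ι : Type*} [Fintype ι] {κ μ : ι → ℝ}
    (h : ∏ i, (Polynomial.X - Polynomial.C (κ i)) = ∏ i, (Polynomial.X - Polynomial.C (μ i))) :
    ∃ σ : Equiv.Perm ι, κ ∘ σ = μ := by
  have h' := congrArg Polynomial.roots h
  have key : ∀ ν : ι → ℝ, (∏ i, (Polynomial.X - Polynomial.C (ν i))).roots =
      Multiset.map ν Finset.univ.val := fun ν => by
    have := Polynomial.roots_multiset_prod_X_sub_C (Multiset.map ν Finset.univ.val)
    rwa [Multiset.map_map] at this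
  rw [key, key] at h'
  have hcard : ∀ y, Nonempty ({i // μ i = y} ≃ {i // κ i = y}) := fun y => by
    classical
    have hy := congrArg (Multiset.count y) h'
    rw [Multiset.count_map, Multiset.count_map] at hy
    refine ⟨Fintype.equivOfCardEq ?_⟩
    rw [Fintype.card_subtype, Fintype.card_subtype, Finset.card_def, Finset.card_def]
    simpa [Finset.filter_val, eq_comm] using hy.symm
  exact ⟨Equiv.ofFiberEquiv fun y => (hcard y).some,
    funext fun i => Equiv.ofFiberEquiv_map (fun y => (hcard y).some) i⟩

/-- The quotient `g⁻¹ h` of two quadratic forms is simultaneously similar, for all `h`, to the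
congruent matrix `Cᴴ h C`. -/
theorem exists_charpoly_inv_mul_eq {ι : Type*} [Fintype ι] [DecidableEq ι] {g : Matrix ι ι ℝ}
    (hg : g.PosDef) : ∃ C : Matrix ι ι ℝ, IsUnit C ∧
      ∀ h : Matrix ι ι ℝ, (g⁻¹ * h).charpoly = (Cᴴ * h * C).charpoly := by
  open scoped MatrixOrder in
  -- Factor `g⁻¹ = C Cᴴ`; then `C (Cᴴ h)` and `(Cᴴ h) C` have the same characteristic polynomial.
  obtain ⟨C, hC⟩ := CStarAlgebra.nonneg_iff_eq_mul_star_self.1 hg.inv.posSemidef.nonneg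
  rw [Matrix.star_eq_conjTranspose] at hC
  refine ⟨C, ?_, fun h => ?_⟩
  · have := hg.inv.isUnit
    rw [hC, Matrix.isUnit_iff_isUnit_det, Matrix.det_mul] at this
    exact (Matrix.isUnit_iff_isUnit_det _).2 (isUnit_of_mul_isUnit_left this)
  · rw [hC, mul_assoc, Matrix.charpoly_mul_comm]

/-- Since `g` is common, one `C` turns both quotients into congruent Hermitian matrices. Congruence
preserves the semidefinite order, and the lists `κ₁`, `κ₂` are permutations of the eigenvalues so
compared. -/
theorem exists_perm_eigenvalues_le {ι : Type*} [Fintype ι] [DecidableEq ι]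
    {g h₁ h₂ : Matrix ι ι ℝ} (hg : g.PosDef) (hh₁ : h₁.IsHermitian) (hh₂ : h₂.IsHermitian)
    {c : ℝ} (hc : 0 ≤ c) (h : (h₂ - c • h₁).PosSemidef) {κ₁ κ₂ : ι → ℝ}
    (hκ₁ : (g⁻¹ * h₁).charpoly = ∏ i, (Polynomial.X - Polynomial.C (κ₁ i)))
    (hκ₂ : (g⁻¹ * h₂).charpoly = ∏ i, (Polynomial.X - Polynomial.C (κ₂ i))) :
    ∃ τ : Equiv.Perm ι, ∀ i, c * κ₁ i ≤ κ₂ (τ i) := by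
  obtain ⟨C, -, hC⟩ := exists_charpoly_inv_mul_eq hg
  have hA := Matrix.isHermitian_conjTranspose_mul_mul C hh₁
  have hB := Matrix.isHermitian_conjTranspose_mul_mul C hh₂
  rw [hC, hA.charpoly_eq] at hκ₁
  rw [hC, hB.charpoly_eq] at hκ₂
  obtain ⟨σ₁, hσ₁⟩ := exists_perm_of_prod_X_sub_C_eq hκ₁.symm
  obtain ⟨σ₂, hσ₂⟩ := exists_perm_of_prod_X_sub_C_eq hκ₂.symm
  refine ⟨σ₁.symm.trans σ₂, fun i => ?_⟩
  have hle := matrix_eigenvalues_le hA hB hc (by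
    have := h.conjTranspose_mul_mul_same C
    rwa [Matrix.mul_sub, Matrix.sub_mul, Matrix.mul_smul, Matrix.smul_mul] at this) (σ₁.symm i)
  have e₁ := congrFun hσ₁ (σ₁.symm i)
  have e₂ := congrFun hσ₂ (σ₁.symm i)
  simp only [Function.comp_apply, Equiv.apply_symm_apply, RCLike.ofReal_real_eq_id, id] at e₁ e₂
  rw [Equiv.trans_apply, e₁, e₂]
  exact hle

/-- The `κ i` are the eigenvalues of `Cᴴ h C`, and congruence by an invertible `C` reflects positive
definiteness. -/
theorem posDef_of_charpoly_inv_mul {ι : Type*} [Fintype ι] [DecidableEq ι]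
    {g h : Matrix ι ι ℝ} (hg : g.PosDef) (hh : h.IsHermitian) {κ : ι → ℝ}
    (hκ : (g⁻¹ * h).charpoly = ∏ i, (Polynomial.X - Polynomial.C (κ i)))
    (hpos : ∀ i, 0 < κ i) : h.PosDef := by
  obtain ⟨C, hCu, hC⟩ := exists_charpoly_inv_mul_eq hg
  have hA := Matrix.isHermitian_conjTranspose_mul_mul C hh
  rw [hC, hA.charpoly_eq] at hκ
  obtain ⟨σ, hσ⟩ := exists_perm_of_prod_X_sub_C_eq hκ.symm
  rw [← Matrix.IsUnit.posDef_star_left_conjugate_iff hCu]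
  refine hA.posDef_iff_eigenvalues_pos.2 fun i => ?_
  have := congrFun hσ i
  simp only [Function.comp_apply, RCLike.ofReal_real_eq_id, id] at this
  rw [← this]
  exact hpos _

end LinearAlgebra

end GammaTranslator

namespace GammaTranslator

/-! ### Graphs in coordinates -/

section GraphFormulas

variable {n : ℕ}

theorem inner_point (x y : Base n) (s t : ℝ) :
    inner ℝ (point x s) (point y t) = inner ℝ x y + s * t := by
  simp [point, PiLp.inner_apply, Fin.sum_univ_castSucc, mul_comm]

theorem dist_point_sq (x y : Base n) (s t : ℝ) :
    dist (point x s) (point y t) ^ 2 = dist x y ^ 2 + (s - t) ^ 2 := by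
  rw [EuclideanSpace.dist_eq, EuclideanSpace.dist_eq, Real.sq_sqrt (by positivity),
    Real.sq_sqrt (by positivity)]
  simp [point, Fin.sum_univ_castSucc, Real.dist_eq]

/-- `(x, t) ↦ point x t` as a continuous linear map. -/
noncomputable def pointCLM (n : ℕ) : Base n × ℝ →L[ℝ] Ambient n :=
  LinearMap.toContinuousLinearMap
    { toFun := fun p => point p.1 p.2
      map_add' := fun p q => by
        ext i
        refine Fin.lastCases ?_ (fun j => ?_) i <;> simp [point]
      map_smul' := fun c p => by
        ext i
        refine Fin.lastCases ?_ (fun j => ?_) i <;> simp [point] }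

@[simp] theorem pointCLM_apply (p : Base n × ℝ) : pointCLM n p = point p.1 p.2 := rfl

theorem pderiv_graphMap {u : Base n → ℝ} {x : Base n} (hu : DifferentiableAt ℝ u x) (i : Fin n) :
    pderiv i (graphMap u) x =
      point (EuclideanSpace.single i 1) (fderiv ℝ u x (EuclideanSpace.single i 1)) := by
  have h : HasFDerivAt (graphMap u)
      ((pointCLM n).comp ((ContinuousLinearMap.id ℝ (Base n)).prod (fderiv ℝ u x))) x :=
    (pointCLM n).hasFDerivAt.comp x ((hasFDerivAt_id x).prodMk hu.hasFDerivAt)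
  rw [pderiv, h.fderiv]
  rfl

theorem pderiv_pderiv_graphMap {u : Base n → ℝ} {x : Base n} (hu : ContDiffAt ℝ 2 u x)
    (i j : Fin n) :
    pderiv i (pderiv j (graphMap u)) x =
      point 0 (fderiv ℝ (fderiv ℝ u) x (EuclideanSpace.single i 1)
        (EuclideanSpace.single j 1)) := by
  have hev : pderiv j (graphMap u) =ᶠ[𝓝 x] fun y =>
      point (EuclideanSpace.single j 1) (fderiv ℝ u y (EuclideanSpace.single j 1)) := by
    filter_upwards [hu.eventually (by simp)] with y hy
    exact pderiv_graphMap (hy.differentiableAt (by simp)) j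
  have hd : DifferentiableAt ℝ (fderiv ℝ u) x :=
    (hu.fderiv_right (m := 1) (by norm_num)).differentiableAt (by simp)
  have h := (pointCLM n).hasFDerivAt.comp x
    ((hasFDerivAt_const (EuclideanSpace.single j (1 : ℝ)) x).prodMk
      (hd.hasFDerivAt.clm_apply (hasFDerivAt_const (EuclideanSpace.single j (1 : ℝ)) x)))
  rw [pderiv, hev.fderiv_eq]
  erw [h.fderiv]
  simp

theorem secondFundamentalForm_apply {u : Base n → ℝ} {x : Base n} (hu : ContDiffAt ℝ 2 u x)
    (i j : Fin n) :
    secondFundamentalForm u x i j = (1 / Real.sqrt (1 + ‖gradient u x‖ ^ 2)) *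
      fderiv ℝ (fderiv ℝ u) x (EuclideanSpace.single i 1) (EuclideanSpace.single j 1) := by
  rw [secondFundamentalForm, Matrix.of_apply, pderiv_pderiv_graphMap hu, unitNormal,
    inner_smul_right, inner_point]
  simp

theorem inner_unitNormal_vertical (u : Base n → ℝ) (x : Base n) :
    inner ℝ (unitNormal u x) (vertical n) = 1 / Real.sqrt (1 + ‖gradient u x‖ ^ 2) := by
  rw [unitNormal, vertical, inner_smul_left, inner_point]
  simp

theorem metricTensor_eq {u : Base n → ℝ} {x : Base n} (hu : DifferentiableAt ℝ u x) :
    metricTensor u x = 1 + Matrix.vecMulVec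
      (fun i => fderiv ℝ u x (EuclideanSpace.single i 1))
      (fun i => fderiv ℝ u x (EuclideanSpace.single i 1)) := by
  ext i j
  rw [metricTensor, Matrix.of_apply, pderiv_graphMap hu, pderiv_graphMap hu, inner_point]
  simp [Matrix.one_apply, Matrix.vecMulVec_apply, EuclideanSpace.inner_single_left]

theorem posDef_metricTensor {u : Base n → ℝ} {x : Base n} (hu : DifferentiableAt ℝ u x) :
    (metricTensor u x).PosDef := by
  rw [metricTensor_eq hu]
  refine Matrix.PosDef.one.add_posSemidef ?_
  simpa using Matrix.posSemidef_vecMulVec_self_star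
    (fun i => fderiv ℝ u x (EuclideanSpace.single i 1))

theorem isHermitian_secondFundamentalForm {u : Base n → ℝ} {x : Base n}
    (hu : ContDiffAt ℝ 2 u x) : (secondFundamentalForm u x).IsHermitian := by
  ext i j
  rw [Matrix.conjTranspose_apply, secondFundamentalForm_apply hu, secondFundamentalForm_apply hu,
    (hu.isSymmSndFDerivAt (by simp)).eq]
  simp

theorem sum_single_smul (v : Base n) : ∑ i, v i • EuclideanSpace.single i (1 : ℝ) = v := by
  simpa using (EuclideanSpace.basisFun (Fin n) ℝ).sum_repr v

theorem dotProduct_secondFundamentalForm {u : Base n → ℝ} {x : Base n}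
    (hu : ContDiffAt ℝ 2 u x) (v : Base n) :
    dotProduct v.ofLp ((secondFundamentalForm u x).mulVec v.ofLp) =
      (1 / Real.sqrt (1 + ‖gradient u x‖ ^ 2)) * fderiv ℝ (fderiv ℝ u) x v v := by
  conv_rhs => rw [← sum_single_smul v]
  simp only [dotProduct, Matrix.mulVec, secondFundamentalForm_apply hu, map_sum, map_smul,
    sum_apply, smul_apply, smul_eq_mul, Finset.mul_sum]
  rw [Finset.sum_comm]
  refine Finset.sum_congr rfl fun i _ => Finset.sum_congr rfl fun j _ => ?_
  ring

end GraphFormulas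

/-! ### Second derivatives along lines -/

section Lines

variable {E : Type*} [NormedAddCommGroup E] [NormedSpace ℝ E]

theorem hasDerivAt_line {f : E → ℝ} {x v : E} {t : ℝ} (hf : DifferentiableAt ℝ f (x + t • v)) :
    HasDerivAt (fun s : ℝ => f (x + s • v)) (fderiv ℝ f (x + t • v) v) t := by
  have hl : HasDerivAt (fun s : ℝ => x + s • v) v t := by
    simpa using ((hasDerivAt_id t).smul_const v).const_add x
  exact hf.hasFDerivAt.comp_hasDerivAt t hl

theorem hasDerivAt_deriv_line {f : E → ℝ} {x v : E} {t : ℝ} (hf : ContDiffAt ℝ 2 f (x + t • v)) :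
    HasDerivAt (deriv fun s : ℝ => f (x + s • v)) (fderiv ℝ (fderiv ℝ f) (x + t • v) v v) t := by
  have hl : HasDerivAt (fun s : ℝ => x + s • v) v t := by
    simpa using ((hasDerivAt_id t).smul_const v).const_add x
  have hd : DifferentiableAt ℝ (fderiv ℝ f) (x + t • v) :=
    (hf.fderiv_right (m := 1) (by norm_num)).differentiableAt (by simp)
  have h1 : HasDerivAt (fun s : ℝ => fderiv ℝ f (x + s • v) v)
      (fderiv ℝ (fderiv ℝ f) (x + t • v) v v) t := by
    exact (ContinuousLinearMap.apply ℝ ℝ v).hasFDerivAt.comp_hasDerivAt t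
      (hd.hasFDerivAt.comp_hasDerivAt t hl)
  refine h1.congr_of_eventuallyEq ?_
  filter_upwards [hl.continuousAt.eventually (hf.eventually (by simp))] with s hs
  exact (hasDerivAt_line (hs.differentiableAt (by simp))).deriv

/-- The second-order necessary condition at a local minimum. -/
theorem fderiv_fderiv_nonneg_of_isLocalMin {f : E → ℝ} {x : E} (hf : ContDiffAt ℝ 2 f x)
    (hmin : IsLocalMin f x) (v : E) : 0 ≤ fderiv ℝ (fderiv ℝ f) x v v := by
  by_contra! hneg
  set φ : ℝ → ℝ := fun s => f (x + s • v) with hφ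
  have h0 : x + (0 : ℝ) • v = x := by simp
  have hd1 : HasDerivAt φ (fderiv ℝ f x v) 0 := by
    have := hasDerivAt_line (f := f) (x := x) (v := v) (t := 0)
      (by rw [h0]; exact hf.differentiableAt (by simp))
    rwa [h0] at this
  have hd2 : HasDerivAt (deriv φ) (fderiv ℝ (fderiv ℝ f) x v v) 0 := by
    have := hasDerivAt_deriv_line (f := f) (x := x) (v := v) (t := 0) (by rwa [h0])
    rwa [h0] at this
  have hmin' : IsLocalMin φ 0 := by
    have hc : Tendsto (fun s : ℝ => x + s • v) (𝓝 0) (𝓝 x) := by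
      have : Continuous fun s : ℝ => x + s • v := by fun_prop
      simpa using this.tendsto 0
    have := hc.eventually hmin
    filter_upwards [this] with s hs
    simpa [hφ] using hs
  -- A negative second derivative would make 0 a local maximum as well, so `φ` would be locally
  -- constant and its second derivative zero.
  have hmax : IsLocalMax φ 0 := isLocalMax_of_deriv_deriv_neg (by rwa [hd2.deriv])
    hmin'.deriv_eq_zero hd1.continuousAt
  have hconst : φ =ᶠ[𝓝 0] fun _ => φ 0 := by
    filter_upwards [hmin', hmax] with s h1 h2 using le_antisymm h2 h1
  have hz : deriv (deriv φ) 0 = 0 := by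
    rw [hconst.deriv.deriv_eq]
    simp
  rw [hd2.deriv] at hz
  exact hneg.ne hz

end Lines

end GammaTranslator

namespace GammaTranslator

/-! ### Intrinsic distance on graphs -/

section IntrinsicDistance

variable {n : ℕ}

theorem edist_le_intrinsicEDist (S : Set (Ambient n)) (p q : Ambient n) :
    edist p q ≤ intrinsicEDist S p q := by
  refine le_iInf₂ fun c hc => ?_
  obtain ⟨-, -, rfl, rfl⟩ := hc
  exact eVariationOn.edist_le c (by simp) (by simp)

theorem intrinsicEDist_le_symm (S : Set (Ambient n)) (p q : Ambient n) :
    intrinsicEDist S p q ≤ intrinsicEDist S q p := by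
  refine le_iInf₂ fun c hc => ?_
  obtain ⟨hc, hS, rfl, rfl⟩ := hc
  have hmaps : MapsTo (fun t : ℝ => 1 - t) (Icc 0 1) (Icc 0 1) := fun t ht =>
    ⟨by linarith [ht.2], by linarith [ht.1]⟩
  have hanti : AntitoneOn (fun t : ℝ => 1 - t) (Icc 0 1) := fun s _ t _ hst => by
    simp only
    linarith
  refine (iInf₂_le (c ∘ fun t => 1 - t)
    ⟨hc.comp (by fun_prop) hmaps, hS.comp hmaps, by simp, by simp⟩).trans ?_
  exact eVariationOn.comp_le_of_antitoneOn c _ hanti hmaps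

theorem intrinsicEDist_comm (S : Set (Ambient n)) (p q : Ambient n) :
    intrinsicEDist S p q = intrinsicEDist S q p :=
  (intrinsicEDist_le_symm S p q).antisymm (intrinsicEDist_le_symm S q p)

theorem dist_le_dist_point (x y : Base n) (s t : ℝ) : dist x y ≤ dist (point x s) (point y t) := by
  refine (pow_le_pow_iff_left₀ dist_nonneg dist_nonneg two_ne_zero).1 ?_
  rw [dist_point_sq]
  nlinarith [sq_nonneg (s - t)]

theorem dist_point_le (x y : Base n) (s t : ℝ) :
    dist (point x s) (point y t) ≤ dist x y + |s - t| := by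
  refine (pow_le_pow_iff_left₀ dist_nonneg (by positivity) two_ne_zero).1 ?_
  rw [dist_point_sq, ← sq_abs (s - t)]
  nlinarith [mul_nonneg (dist_nonneg (x := x) (y := y)) (abs_nonneg (s - t))]

/-- The length of an increasing profile is at most the sum of its horizontal and vertical
displacements. -/
theorem intrinsicEDist_ray_le {Ω : Set (Base n)} {u : Base n → ℝ} (hu : ContinuousOn u Ω)
    {e : Base n} (he : ‖e‖ = 1) {a b : ℝ} (hab : a ≤ b) (hΩ : ∀ t ∈ Icc a b, t • e ∈ Ω)
    (hmono : MonotoneOn (fun t : ℝ => u (t • e)) (Icc a b)) :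
    intrinsicEDist (graphOver Ω u) (graphMap u (a • e)) (graphMap u (b • e)) ≤
      ENNReal.ofReal ((b + u (b • e)) - (a + u (a • e))) := by
  set l : ℝ → ℝ := fun t => a + t * (b - a) with hl
  have hlm : Monotone l := fun s t hst => by
    have := mul_le_mul_of_nonneg_right hst (sub_nonneg.2 hab)
    simp only [hl]
    linarith
  have hl0 : l 0 = a := by simp [hl]
  have hl1 : l 1 = b := by simp [hl]
  have hlI : MapsTo l (Icc 0 1) (Icc a b) := fun t ht => by
    refine ⟨?_, ?_⟩
    · rw [← hl0]; exact hlm ht.1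
    · rw [← hl1]; exact hlm ht.2
  set ψ : ℝ → ℝ := fun t => l t + u (l t • e) with hψ
  have hψm : MonotoneOn ψ (Icc 0 1) := fun s hs t ht hst =>
    add_le_add (hlm hst) (hmono (hlI hs) (hlI ht) (hlm hst))
  have hgraph : ContinuousOn (graphMap u) Ω :=
    (pointCLM n).continuous.comp_continuousOn (continuousOn_id.prodMk hu)
  have hlc : Continuous l := by fun_prop
  refine (iInf₂_le (fun t => graphMap u (l t • e))
    ⟨hgraph.comp (by fun_prop) fun t ht => hΩ _ (hlI ht),
      fun t ht => ⟨_, hΩ _ (hlI ht), rfl⟩, by simp [hl0], by simp [hl1]⟩).trans ?_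
  -- Each chord of the lifted ray is at most the increment of `ψ`, the sum of radius and height. As
  -- `ψ` is monotone, its variation is its total increment.
  have hle : ∀ s ∈ Icc (0 : ℝ) 1, ∀ t ∈ Icc (0 : ℝ) 1, s ≤ t →
      edist (graphMap u (l t • e)) (graphMap u (l s • e)) ≤ edist (ψ t) (ψ s) := by
    intro s hs t ht hst
    rw [edist_dist, edist_dist]
    refine ENNReal.ofReal_le_ofReal ((dist_point_le _ _ _ _).trans ?_)
    have h1 := hlm hst
    have h2 := hmono (hlI hs) (hlI ht) h1
    have h3 := hψm hs ht hst
    simp only at h2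
    rw [dist_eq_norm, ← sub_smul, norm_smul, he, mul_one, Real.norm_eq_abs,
      abs_of_nonneg (sub_nonneg.2 h1), abs_of_nonneg (sub_nonneg.2 h2), Real.dist_eq,
      abs_of_nonneg (sub_nonneg.2 h3)]
    simp only [hψ]
    linarith
  have hvar := hψm.eVariationOn_eq (a := 0) (b := 1) (by simp) (by simp)
  simp only [hψ, hl0, hl1, inter_self] at hvar
  refine le_trans (iSup_le fun p => ?_) hvar.le
  obtain ⟨N, v, hv, hvI⟩ := p
  refine le_trans (Finset.sum_le_sum fun i _ => ?_)
    (eVariationOn.sum_le (f := ψ) (n := N) hv hvI)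
  exact hle _ (hvI i) _ (hvI (i + 1)) (hv i.le_succ)

end IntrinsicDistance

/-! ### Bowls over balls blow up at the boundary -/

section Bowl

variable {n : ℕ} {Γ : Set (Fin n → ℝ)} {γ : (Fin n → ℝ) → ℝ}

theorem IsGraphicalTranslator.contDiffAt {Ω : Set (Base n)} {u : Base n → ℝ}
    (hu : IsGraphicalTranslator Γ γ Ω u) (hΩ : IsOpen Ω) {x : Base n} (hx : x ∈ Ω) :
    ContDiffAt ℝ 2 u x :=
  contDiffAt_infty.1 (hu.smooth.contDiffAt (hΩ.mem_nhds hx)) 2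

/-- The second fundamental form is a positive multiple of the Hessian, so positive curvatures yield
a nonnegative Hessian. -/
theorem fderiv_fderiv_nonneg_of_isStrictlyConvexGraph {Ω : Set (Base n)} {u : Base n → ℝ}
    (hu : IsGraphicalTranslator Γ γ Ω u) (hΩ : IsOpen Ω) (hc : IsStrictlyConvexGraph Ω u)
    {x : Base n} (hx : x ∈ Ω) (v : Base n) : 0 ≤ fderiv ℝ (fderiv ℝ u) x v v := by
  have hux := hu.contDiffAt hΩ hx
  obtain ⟨κ, hκ, -⟩ := hu.equation x hx
  have hpos := (posDef_of_charpoly_inv_mul (posDef_metricTensor (hux.differentiableAt (by simp)))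
    (isHermitian_secondFundamentalForm hux) hκ (hc x hx κ hκ)).posSemidef
  have := hpos.dotProduct_mulVec_nonneg v.ofLp
  rw [star_trivial, dotProduct_secondFundamentalForm hux] at this
  exact nonneg_of_mul_nonneg_right this (by positivity)

theorem convexOn_line {Ω : Set (Base n)} {u : Base n → ℝ}
    (hu : ∀ x ∈ Ω, ContDiffAt ℝ 2 u x)
    (hc : ∀ x ∈ Ω, ∀ v, 0 ≤ fderiv ℝ (fderiv ℝ u) x v v) {x v : Base n} {D : Set ℝ}
    (hD : Convex ℝ D) (hDΩ : ∀ t ∈ D, x + t • v ∈ Ω) :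
    ConvexOn ℝ D fun t => u (x + t • v) := by
  refine convexOn_of_deriv2_nonneg' hD
    (fun t ht => (hasDerivAt_line ((hu _ (hDΩ t ht)).differentiableAt
      (by simp))).differentiableAt.differentiableWithinAt)
    (fun t ht => (hasDerivAt_deriv_line (hu _ (hDΩ t ht))).differentiableAt.differentiableWithinAt)
    fun t ht => ?_
  simp only [Function.iterate_succ, Function.iterate_zero, Function.comp_apply, id]
  rw [(hasDerivAt_deriv_line (hu _ (hDΩ t ht))).deriv]
  exact hc _ (hDΩ t ht) v

variable {r : ℝ} {b : Base n → ℝ}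

/-- Along the diameter segment from `-y` to `y` the function is convex with equal end values, so
they bound its value at the point of norm `‖x‖`, which is `b x` by symmetry. -/
theorem IsBowlOverBall.monotone (hb : IsBowlOverBall Γ γ r b) {x y : Base n}
    (hxy : ‖x‖ ≤ ‖y‖) (hy : ‖y‖ < r) : b x ≤ b y := by
  rcases eq_or_ne y 0 with rfl | hy0
  · have : x = 0 := by simpa using hxy
    rw [this]
  have hypos : 0 < ‖y‖ := norm_pos_iff.2 hy0
  have hmem : ∀ t ∈ Icc (-1 : ℝ) 1, (0 : Base n) + t • y ∈ Metric.ball (0 : Base n) r := by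
    intro t ht
    rw [zero_add, mem_ball_zero_iff, norm_smul, Real.norm_eq_abs]
    exact (mul_le_of_le_one_left hypos.le (abs_le.2 ht)).trans_lt hy
  have hconv := convexOn_line (fun z hz => hb.translator.contDiffAt Metric.isOpen_ball hz)
    (fun z hz v => fderiv_fderiv_nonneg_of_isStrictlyConvexGraph hb.translator
      Metric.isOpen_ball hb.strictly_convex hz v) (convex_Icc (-1 : ℝ) 1) hmem
  have hs : ‖x‖ / ‖y‖ ∈ Icc (-1 : ℝ) 1 :=
    ⟨by linarith [div_nonneg (norm_nonneg x) hypos.le], (div_le_one hypos).2 hxy⟩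
  have hle := hconv.le_max_of_mem_Icc (left_mem_Icc.2 (by norm_num)) (right_mem_Icc.2 (by norm_num))
    hs
  have hsym : b (-y) = b y := hb.rotationally_symmetric _ (by simpa using hy) _ (by simpa using hy)
    (norm_neg y)
  have hx : b x = b ((‖x‖ / ‖y‖) • y) := by
    refine hb.rotationally_symmetric _ (by simpa using hxy.trans_lt hy) _ ?_ ?_
    · simpa using hmem _ hs
    · rw [norm_smul, norm_div, norm_norm, norm_norm, div_mul_cancel₀ _ hypos.ne']
  rw [hx]
  simpa [hsym] using hle

/-- If `b` were bounded on a ray, the ray lifted to the graph would have finite length up to the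
boundary. Completeness would then put a limit in the graph, over a point of norm `r`, outside the
open ball. -/
theorem IsBowlOverBall.exists_lt_of_norm_ge (hn : 1 ≤ n) (hr : 0 < r)
    (hb : IsBowlOverBall Γ γ r b) (M : ℝ) :
    ∃ ρ, 0 < ρ ∧ ρ < r ∧ ∀ x, ρ ≤ ‖x‖ → ‖x‖ < r → M < b x := by
  set e : Base n := EuclideanSpace.single ⟨0, hn⟩ 1 with he_def
  have he : ‖e‖ = 1 := by simp [he_def]
  have hnorm : ∀ t : ℝ, 0 ≤ t → ‖t • e‖ = t := fun t ht => by
    rw [norm_smul, he, mul_one, Real.norm_of_nonneg ht]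
  suffices h : ∃ t, 0 ≤ t ∧ t < r ∧ M < b (t • e) by
    obtain ⟨t, ht0, htr, hM⟩ := h
    -- Radial monotonicity spreads the bound from one point to the outer annulus; `r / 2` only keeps
    -- the radius positive.
    refine ⟨max t (r / 2), by positivity, max_lt htr (by linarith), fun x hx hxr =>
      hM.trans_le (hb.monotone ?_ hxr)⟩
    rw [hnorm t ht0]
    exact (le_max_left _ _).trans hx
  by_contra! hbd
  have hmono : ∀ s t : ℝ, 0 ≤ s → s ≤ t → t < r → b (s • e) ≤ b (t • e) := fun s t hs hst ht =>
    hb.monotone (by rwa [hnorm s hs, hnorm t (hs.trans hst)]) (by rwa [hnorm t (hs.trans hst)])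
  obtain ⟨t, htm, htI, htr⟩ := exists_seq_strictMono_tendsto' hr
  have hcont : ContinuousOn b (Metric.ball 0 r) := hb.translator.smooth.continuousOn
  set ψ : ℕ → ℝ := fun k => t k + b (t k • e) with hψ
  have hψm : Monotone ψ := fun k m hkm => add_le_add (htm.monotone hkm)
    (hmono _ _ (htI k).1.le (htm.monotone hkm) (htI m).2)
  have hψb : BddAbove (range ψ) := ⟨r + M, by
    rintro _ ⟨k, rfl⟩
    exact add_le_add (htI k).2.le (hbd _ (htI k).1.le (htI k).2)⟩
  have hψc : CauchySeq ψ := (tendsto_atTop_ciSup hψm hψb).cauchySeq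
  set S := graphOver (Metric.ball 0 r) b with hS
  set s : ℕ → Ambient n := fun k => graphMap b (t k • e) with hs
  have hball : ∀ a : ℝ, 0 ≤ a → a < r → a • e ∈ Metric.ball (0 : Base n) r := fun a h0 h1 => by
    rwa [mem_ball_zero_iff, hnorm a h0]
  have hle : ∀ k m, k ≤ m → intrinsicEDist S (s k) (s m) ≤ edist (ψ k) (ψ m) := by
    intro k m hkm
    rw [edist_comm, edist_dist, Real.dist_eq, abs_of_nonneg (sub_nonneg.2 (hψm hkm))]
    refine intrinsicEDist_ray_le hcont he (htm.monotone hkm)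
      (fun a ha => hball a ((htI k).1.le.trans ha.1) (ha.2.trans_lt (htI m).2)) ?_
    intro a ha a' ha' haa'
    exact hmono a a' ((htI k).1.le.trans ha.1) haa' (ha'.2.trans_lt (htI m).2)
  obtain ⟨p, ⟨x, hx, rfl⟩, hp⟩ := hb.complete s
    (fun k => ⟨_, hball _ (htI k).1.le (htI k).2, rfl⟩) fun ε hε => by
      obtain ⟨N, hN⟩ := EMetric.cauchySeq_iff.1 hψc ε hε
      refine ⟨N, fun k hk m hm => ?_⟩
      rcases le_total k m with hkm | hkm
      · exact (hle k m hkm).trans_lt (hN k hk m hm)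
      · rw [intrinsicEDist_comm]
        exact (hle m k hkm).trans_lt (hN m hm k hk)
  -- Intrinsic distance dominates horizontal distance, so the base points converge too.
  have hxt : Tendsto (fun k => t k • e) atTop (𝓝 x) := by
    rw [tendsto_iff_edist_tendsto_0]
    refine tendsto_of_tendsto_of_tendsto_of_le_of_le tendsto_const_nhds hp (fun _ => zero_le)
      fun k => ?_
    refine le_trans ?_ (edist_le_intrinsicEDist S _ _)
    rw [edist_dist, edist_dist]
    exact ENNReal.ofReal_le_ofReal (dist_le_dist_point _ _ _ _)
  have hxr : ‖x‖ = r := by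
    refine tendsto_nhds_unique hxt.norm ?_
    simpa only [hnorm _ (htI _).1.le] using htr
  rw [mem_ball_zero_iff] at hx
  exact hx.ne hxr

end Bowl

end GammaTranslator

namespace GammaTranslator

/-! ### Monotonicity of the curvature function -/

section CurvatureFunction

variable {n : ℕ} {Γ : Set (Fin n → ℝ)} {γ : (Fin n → ℝ) → ℝ} {α : ℝ}

/-- The segment from `κ` to `μ` lies in the positive cone except perhaps at `κ`, which may be on the
boundary of `Γ`. The derivative is used for positive times, and continuity on `closure Γ` reaches
time 0. -/
theorem IsCurvatureFunction.le_of_le (hγ : IsCurvatureFunction Γ γ α) {κ μ : Fin n → ℝ}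
    (hκ : ∀ i, 0 ≤ κ i) (hκΓ : κ ∈ closure Γ) (hμ : ∀ i, 0 < μ i) (hκμ : ∀ i, κ i ≤ μ i) :
    γ κ ≤ γ μ := by
  set l : ℝ → Fin n → ℝ := fun t => κ + t • (μ - κ) with hl
  have hlΓ : ∀ t ∈ Ioc (0 : ℝ) 1, l t ∈ Γ := fun t ht => hγ.positive_cone_subset fun i => by
    have h1 := mul_nonneg (sub_nonneg.2 ht.2) (hκ i)
    have h2 := mul_pos ht.1 (hμ i)
    simp only [hl, Pi.add_apply, Pi.smul_apply, Pi.sub_apply, smul_eq_mul]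
    linarith
  have hl0 : l 0 = κ := by simp [hl]
  have hl1 : l 1 = μ := by simp [hl]
  have hlcl : MapsTo l (Icc 0 1) (closure Γ) := fun t ht => by
    rcases ht.1.eq_or_lt with rfl | h0
    · rwa [hl0]
    · exact subset_closure (hlΓ t ⟨h0, ht.2⟩)
  have hderiv : ∀ t ∈ Ioc (0 : ℝ) 1, HasDerivAt (γ ∘ l) (fderiv ℝ γ (l t) (μ - κ)) t := by
    intro t ht
    have h1 : HasDerivAt l (μ - κ) t := by
      have := ((hasDerivAt_id t).smul_const (μ - κ)).const_add κ
      rwa [one_smul] at this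
    have h2 : DifferentiableAt ℝ γ (l t) :=
      (hγ.smooth.contDiffAt (hγ.isOpen_cone.mem_nhds (hlΓ t ht))).differentiableAt (by simp)
    exact h2.hasFDerivAt.comp_hasDerivAt t h1
  have hmono : MonotoneOn (γ ∘ l) (Icc 0 1) := by
    refine monotoneOn_of_deriv_nonneg (convex_Icc 0 1)
      (hγ.continuousOn_closure.comp (by fun_prop) hlcl) ?_ ?_ <;> rw [interior_Icc]
    · exact fun t ht => (hderiv t ⟨ht.1, ht.2.le⟩).differentiableAt.differentiableWithinAt
    · intro t ht
      rw [(hderiv t ⟨ht.1, ht.2.le⟩).deriv, pi_eq_sum_univ' (μ - κ), map_sum]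
      refine Finset.sum_nonneg fun i _ => ?_
      rw [map_smul, smul_eq_mul]
      refine mul_nonneg (sub_nonneg.2 (hκμ i)) ?_
      exact (hγ.increasing _ (hlΓ t ⟨ht.1, ht.2.le⟩) i).le
  simpa [hl0, hl1] using hmono (left_mem_Icc.2 zero_le_one) (right_mem_Icc.2 zero_le_one)
    zero_le_one

end CurvatureFunction

/-! ### Touching an entire graph by a dilated bowl -/

section Touching

variable {n : ℕ}

theorem metricTensor_congr {u v : Base n → ℝ} {x y : Base n} (hu : DifferentiableAt ℝ u x)
    (hv : DifferentiableAt ℝ v y) (h : fderiv ℝ u x = fderiv ℝ v y) :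
    metricTensor u x = metricTensor v y := by
  rw [metricTensor_eq hu, metricTensor_eq hv, h]

theorem gradient_congr {u v : Base n → ℝ} {x y : Base n} (h : fderiv ℝ u x = fderiv ℝ v y) :
    gradient u x = gradient v y := by
  rw [gradient, gradient, h]

/-- At a point where the dilation `2 b(·/2)` touches `u` from above, the first derivatives agree
and the second derivatives are ordered. -/
theorem derivatives_of_isLocalMin_dilation {u b : Base n → ℝ} {y : Base n}
    (hb : ContDiffAt ℝ 2 b y) (hu : ContDiff ℝ 2 u)
    (hmin : IsLocalMin (fun z => 2 * b z - u ((2 : ℝ) • z)) y) :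
    fderiv ℝ b y = fderiv ℝ u ((2 : ℝ) • y) ∧
      ∀ v, 2 * fderiv ℝ (fderiv ℝ u) ((2 : ℝ) • y) v v ≤ fderiv ℝ (fderiv ℝ b) y v v := by
  have hu2 : ContDiff ℝ 2 fun z : Base n => u ((2 : ℝ) • z) := hu.comp (contDiff_const_smul _)
  have hfd : ∀ z, DifferentiableAt ℝ b z →
      fderiv ℝ (fun z => 2 * b z - u ((2 : ℝ) • z)) z =
        (2 : ℝ) • fderiv ℝ b z - (2 : ℝ) • fderiv ℝ u ((2 : ℝ) • z) := fun z hz => by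
    rw [fderiv_fun_sub (hz.const_mul 2) ((hu2.differentiable (by simp)) z),
      fderiv_const_mul hz, fderiv_comp_smul]
  have hb1 := hb.differentiableAt (by simp)
  refine ⟨?_, fun v => ?_⟩
  · have h0 := hmin.fderiv_eq_zero
    rw [hfd y hb1, ← smul_sub, smul_eq_zero] at h0
    exact sub_eq_zero.1 (h0.resolve_left two_ne_zero)
  · have hnn := fderiv_fderiv_nonneg_of_isLocalMin
      ((contDiffAt_const.mul hb).sub hu2.contDiffAt) hmin v
    have hev : fderiv ℝ (fun z => 2 * b z - u ((2 : ℝ) • z)) =ᶠ[𝓝 y] fun z =>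
        (2 : ℝ) • fderiv ℝ b z - (2 : ℝ) • fderiv ℝ u ((2 : ℝ) • z) := by
      filter_upwards [hb.eventually (by simp)] with z hz
      exact hfd z (hz.differentiableAt (by simp))
    have hdb : DifferentiableAt ℝ (fderiv ℝ b) y :=
      (hb.fderiv_right (m := 1) (by norm_num)).differentiableAt (by simp)
    have hdu : Differentiable ℝ (fderiv ℝ u) :=
      (hu.fderiv_right (m := 1) (by norm_num)).differentiable (by simp)
    have hdu2 : DifferentiableAt ℝ (fun z : Base n => fderiv ℝ u ((2 : ℝ) • z)) y :=
      (hdu _).comp y (differentiableAt_id.const_smul (2 : ℝ))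
    have hH : HasFDerivAt
        (fun z => (2 : ℝ) • fderiv ℝ b z - (2 : ℝ) • fderiv ℝ u ((2 : ℝ) • z)) _ y :=
      (hdb.hasFDerivAt.const_smul (2 : ℝ)).sub (hdu2.hasFDerivAt.const_smul (2 : ℝ))
    -- The chain rule gives `u(2z)` a factor 4 at second order, against 2 for `2 b`; this leaves the
    -- factor 2 in the conclusion.
    rw [hev.fderiv_eq, hH.fderiv, fderiv_comp_smul] at hnn
    simp only [sub_apply, smul_apply, smul_eq_mul] at hnn
    linarith

/-- At such a touching point twice the principal curvatures of `u` are bounded by those of `b`. -/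
theorem exists_perm_two_mul_le {u b : Base n → ℝ} {y : Base n}
    (hb : ContDiffAt ℝ 2 b y) (hu : ContDiff ℝ 2 u)
    (hmin : IsLocalMin (fun z => 2 * b z - u ((2 : ℝ) • z)) y) {κ μ : Fin n → ℝ}
    (hκ : IsPrincipalCurvatureVector u ((2 : ℝ) • y) κ) (hμ : IsPrincipalCurvatureVector b y μ) :
    ∃ τ : Equiv.Perm (Fin n), ∀ i, 2 * κ i ≤ μ (τ i) := by
  obtain ⟨h1, h2⟩ := derivatives_of_isLocalMin_dilation hb hu hmin
  have hu1 : DifferentiableAt ℝ u ((2 : ℝ) • y) := hu.differentiable (by simp) _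
  have hb1 := hb.differentiableAt (by simp)
  have hsu := isHermitian_secondFundamentalForm (x := (2 : ℝ) • y) hu.contDiffAt
  have hsb := isHermitian_secondFundamentalForm hb
  unfold IsPrincipalCurvatureVector weingarten at hκ hμ
  -- Equal gradients give equal metrics and equal normalizing factors, so ordered Hessians mean
  -- ordered second fundamental forms.
  rw [← metricTensor_congr hb1 hu1 h1] at hκ
  refine exists_perm_eigenvalues_le (posDef_metricTensor hb1) hsu hsb zero_le_two ?_ hκ hμ
  refine .of_dotProduct_mulVec_nonneg (hsb.sub (hsu.smul (by simp))) fun v => ?_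
  have e1 := dotProduct_secondFundamentalForm hb (WithLp.toLp 2 v)
  have e2 := dotProduct_secondFundamentalForm (x := (2 : ℝ) • y) hu.contDiffAt (WithLp.toLp 2 v)
  rw [← gradient_congr h1] at e2
  simp only at e1 e2
  rw [star_trivial, Matrix.sub_mulVec, dotProduct_sub, Matrix.smul_mulVec, dotProduct_smul, e1, e2,
    smul_eq_mul, mul_left_comm, ← mul_sub]
  exact mul_nonneg (by positivity) (sub_nonneg.2 (h2 _))

/-- A function that exceeds its value at the centre near the boundary of a ball has a local minimum
in the ball. -/
theorem exists_isLocalMin_of_boundary_lt {f : Base n → ℝ} {r ρ : ℝ} (hρ : 0 < ρ) (hρr : ρ < r)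
    (hf : ContinuousOn f (Metric.ball 0 r))
    (hbd : ∀ x, ρ ≤ ‖x‖ → ‖x‖ < r → f 0 < f x) :
    ∃ y ∈ Metric.ball (0 : Base n) r, IsLocalMin f y := by
  obtain ⟨y, hy, hmin⟩ := (isCompact_closedBall (0 : Base n) ρ).exists_isMinOn
    ⟨0, Metric.mem_closedBall_self hρ.le⟩ (hf.mono (Metric.closedBall_subset_ball hρr))
  have hyr := Metric.closedBall_subset_ball hρr hy
  refine ⟨y, hyr, ?_⟩
  filter_upwards [Metric.isOpen_ball.mem_nhds hyr] with z hz
  rcases le_or_gt ‖z‖ ρ with h | h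
  · exact hmin (mem_closedBall_zero_iff.2 h)
  · exact (hmin (Metric.mem_closedBall_self hρ.le)).trans
      (hbd z h.le (mem_ball_zero_iff.1 hz)).le

end Touching

end GammaTranslator

/-! ### The contradiction at the touching point -/

theorem corollary1p3 {n : ℕ} (hn : 1 ≤ n) (Γ : Set (Fin n → ℝ)) (γ : (Fin n → ℝ) → ℝ) (α : ℝ)
    (hγ : GammaTranslator.IsCurvatureFunction Γ γ α) (hα : 1 / 2 < α)
    (hbowl : ∃ r : ℝ, 0 < r ∧ ∃ b : EuclideanSpace ℝ (Fin n) → ℝ,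
      GammaTranslator.IsBowlOverBall Γ γ r b) :
    ¬ ∃ u : EuclideanSpace ℝ (Fin n) → ℝ,
      GammaTranslator.IsCompleteConvexEntireTranslator Γ γ u := by
  open GammaTranslator in
  rintro ⟨u, hu⟩
  obtain ⟨r, hr, b, hb⟩ := hbowl
  have hu2 : ContDiff ℝ 2 u := contDiff_iff_contDiffAt.2 fun x =>
    hu.translator.contDiffAt isOpen_univ (mem_univ x)
  have huc : Continuous fun z : Base n => u ((2 : ℝ) • z) :=
    hu2.continuous.comp (continuous_const_smul _)
  obtain ⟨K, hK⟩ := (isCompact_closedBall (0 : Base n) r).bddAbove_image huc.continuousOn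
  -- With `u(2x) ≤ K` on the ball, this threshold is what makes `2 b x - u(2x)` exceed its value at
  -- the centre.
  obtain ⟨ρ, hρ0, hρr, hρ⟩ := hb.exists_lt_of_norm_ge hn hr ((2 * b 0 - u 0 + K) / 2)
  obtain ⟨y, hy, hmin⟩ := exists_isLocalMin_of_boundary_lt
    (f := fun z => 2 * b z - u ((2 : ℝ) • z)) hρ0 hρr
    ((continuousOn_const.mul hb.translator.smooth.continuousOn).sub huc.continuousOn)
    fun x hx hxr => by
      have h1 := hρ x hx hxr
      have h2 : u ((2 : ℝ) • x) ≤ K := hK ⟨x, mem_closedBall_zero_iff.2 hxr.le, rfl⟩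
      simp only [smul_zero]
      linarith
  have hby := hb.translator.contDiffAt Metric.isOpen_ball hy
  obtain ⟨κ, hκ, hκΓ, hγκ⟩ := hu.translator.equation ((2 : ℝ) • y) (mem_univ _)
  obtain ⟨μ, hμ, -, hγμ⟩ := hb.translator.equation y hy
  have hκ0 := hu.convex _ (mem_univ _) κ hκ
  have hμ0 := hb.strictly_convex y hy μ hμ
  have hμΓ : μ ∈ Γ := hγ.positive_cone_subset hμ0
  obtain ⟨τ, hτ⟩ := exists_perm_two_mul_le hby hu2 hmin hκ hμ
  have hle : γ κ ≤ γ ((1 / 2 : ℝ) • (μ ∘ τ)) := by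
    refine hγ.le_of_le hκ0 hκΓ (fun i => ?_) fun i => ?_
    · simpa using hμ0 (τ i)
    · have := hτ i
      simp only [Pi.smul_apply, Function.comp_apply, smul_eq_mul]
      linarith
  rw [hγ.homogeneous _ (hγ.perm_mem μ hμΓ τ) _ (by norm_num), hγ.symmetric μ hμΓ τ] at hle
  -- Both sides are `1 / √(1 + |∇|²)` for the gradient shared at the touching point.
  have heq : γ κ = γ μ := by
    rw [hγκ, hγμ, inner_unitNormal_vertical, inner_unitNormal_vertical,
      gradient_congr (derivatives_of_isLocalMin_dilation hby hu2 hmin).1]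
  have hlt : (1 / 2 : ℝ) ^ α < 1 :=
    Real.rpow_lt_one (by norm_num) (by norm_num) hγ.degree_pos
  have := mul_lt_mul_of_pos_right hlt (hγ.pos μ hμΓ)
  linarith
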